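/- Let $a > 0$, let $\ell^2(\mathbf N)$ be the complex Hilbert space of square-summable sequences with standard orthonormal basis $(\varepsilon_n)_{n \ge 0}$, and let $J_a$ be the bounded self-adjoint operator on $\ell^2(\mathbf N)$ whose matrix with respect to this basis is the symmetric tridiagonal matrix $$ J_a = \begin{pmatrix} 0 & a & 0 & 0 & \cdots \\ a & 0 & 1 & 0 & \cdots \\ 0 & 1 & 0 & 1 & \cdots \\ 0 & 0 & 1 & 0 & \cdots \\ \vdots & \vdots & \vdots & \vdots & \ddots \end{pmatrix}, $$ with zero diagonal and subdiagonal entries $(a, 1, 1, 1, \ldots)$. Then, for every $n \ge 0$, the vector $\varepsilon_n$ is cyclic for $J_a$, that is, the closed linear span of $\{ J_a^k \varepsilon_n : k \in \mathbf N \}$ is the whole of $\ell^2(\mathbf N)$. -/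

import Mathlib

/-- The complex Hilbert space `ℓ²(ℕ)`. -/
abbrev EllTwo : Type := lp (fun _ : ℕ => ℂ) 2

/-- The standard basis vector `ε_n` of `ℓ²(ℕ)`. -/
noncomputable def stdVec (n : ℕ) : EllTwo := lp.single 2 n (1 : ℂ)

/-- The subdiagonal entries `(a, 1, 1, 1, …)`. -/
def jacobiWeight (a : ℝ) (n : ℕ) : ℝ := if n = 0 then a else 1

/-- The symmetric tridiagonal `ℕ × ℕ` matrix with zero diagonal and with subdiagonal (and
superdiagonal) entries `(a, 1, 1, 1, …)`. -/
def jacobiMatrix (a : ℝ) : Matrix ℕ ℕ ℝ := fun i j =>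
  if i = j + 1 then jacobiWeight a j else if j = i + 1 then jacobiWeight a i else 0

/-- The action of `jacobiMatrix a` on a sequence, row by row. -/
noncomputable def jacobiFun (a : ℝ) (x : ℕ → ℂ) : ℕ → ℂ
  | 0 => (jacobiWeight a 0 : ℂ) * x 1
  | n + 1 => (jacobiWeight a n : ℂ) * x n + (jacobiWeight a (n + 1) : ℂ) * x (n + 2)

theorem abs_jacobiWeight_le (a : ℝ) (n : ℕ) : |jacobiWeight a n| ≤ |a| + 1 := by
  unfold jacobiWeight
  split_ifs
  · linarith
  · simp

theorem summable_norm_sq_ellTwo (x : EllTwo) : Summable fun n => ‖x n‖ ^ 2 := by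
  have h := (lp.memℓp x).summable (by norm_num)
  simpa using h

theorem memℓp_jacobiFun (a : ℝ) (x : EllTwo) : Memℓp (E := fun _ : ℕ => ℂ) (jacobiFun a x) 2 := by
  apply memℓp_gen
  have hx := summable_norm_sq_ellTwo x
  have h2 := (summable_nat_add_iff 2).2 hx
  rw [← summable_nat_add_iff 1]
  refine Summable.of_nonneg_of_le (fun n => by positivity) (fun n => ?_)
    ((hx.add h2).mul_left (2 * (|a| + 1) ^ 2))
  have e : ((2 : ENNReal).toReal) = ((2 : ℕ) : ℝ) := by norm_num
  rw [e, Real.rpow_natCast]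
  have hb : ‖jacobiFun a x (n + 1)‖ ≤ (|a| + 1) * (‖x n‖ + ‖x (n + 2)‖) := by
    change ‖(jacobiWeight a n : ℂ) * x n + (jacobiWeight a (n + 1) : ℂ) * x (n + 2)‖ ≤ _
    refine (norm_add_le _ _).trans ?_
    rw [norm_mul, norm_mul, Complex.norm_real, Complex.norm_real, Real.norm_eq_abs,
      Real.norm_eq_abs, mul_add]
    gcongr <;> apply abs_jacobiWeight_le
  calc ‖jacobiFun a x (n + 1)‖ ^ 2 ≤ ((|a| + 1) * (‖x n‖ + ‖x (n + 2)‖)) ^ 2 := by gcongr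
    _ = (|a| + 1) ^ 2 * (‖x n‖ + ‖x (n + 2)‖) ^ 2 := by ring
    _ ≤ (|a| + 1) ^ 2 * (2 * (‖x n‖ ^ 2 + ‖x (n + 2)‖ ^ 2)) := by
        gcongr
        nlinarith [sq_nonneg (‖x n‖ - ‖x (n + 2)‖)]
    _ = _ := by ring

/-- The linear endomorphism of `ℓ²(ℕ)` given by `jacobiMatrix a`. -/
noncomputable def jacobiLin (a : ℝ) : EllTwo →ₗ[ℂ] EllTwo where
  toFun x := ⟨jacobiFun a x, memℓp_jacobiFun a x⟩
  map_add' x y := by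
    apply lp.ext
    funext n
    change jacobiFun a (fun k => x k + y k) n = jacobiFun a x n + jacobiFun a y n
    cases n <;> simp only [jacobiFun] <;> ring
  map_smul' c x := by
    apply lp.ext
    funext n
    change jacobiFun a (fun k => c * x k) n = c * jacobiFun a x n
    cases n <;> simp only [jacobiFun] <;> ring

theorem tendsto_zero_ellTwo (x : EllTwo) :
    Filter.Tendsto (fun n => x n) Filter.atTop (nhds 0) := by
  have h := (summable_norm_sq_ellTwo x).tendsto_atTop_zero
  rw [tendsto_zero_iff_norm_tendsto_zero]
  have h' := h.sqrt
  simpa [Real.sqrt_sq (norm_nonneg _)] using h'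

theorem jacobiLin_isSymmetric (a : ℝ) : (jacobiLin a).IsSymmetric := by
  intro x y
  have hd := ((lp.hasSum_inner (𝕜 := ℂ) (jacobiLin a x) y).sub
    (lp.hasSum_inner (𝕜 := ℂ) x (jacobiLin a y))).tendsto_sum_nat
  have hd' := hd.comp (Filter.tendsto_add_atTop_nat 1)
  -- the partial sums telescope
  have hs : ∀ N : ℕ, ∑ n ∈ Finset.range (N + 1),
      (inner ℂ (jacobiLin a x n) (y n) - inner ℂ (x n) (jacobiLin a y n)) =
      (jacobiWeight a N : ℂ) *
        (star (x (N + 1)) * y N - star (x N) * y (N + 1)) := by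
    intro N
    induction N with
    | zero =>
      rw [Finset.sum_range_one]
      change (y 0 * star (jacobiFun a x 0) - jacobiFun a y 0 * star (x 0) : ℂ) = _
      simp only [jacobiFun, star_mul', Complex.star_def, Complex.conj_ofReal]
      ring
    | succ N ih =>
      rw [Finset.sum_range_succ, ih]
      change _ + (y (N + 1) * star (jacobiFun a x (N + 1))
        - jacobiFun a y (N + 1) * star (x (N + 1)) : ℂ) = _
      simp only [jacobiFun, star_mul', star_add, Complex.star_def, Complex.conj_ofReal]
      ring
  have h0 : Filter.Tendsto (fun N : ℕ => (jacobiWeight a N : ℂ) *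
      (star (x (N + 1)) * y N - star (x N) * y (N + 1))) Filter.atTop (nhds 0) := by
    have hx := tendsto_zero_ellTwo x
    have hy := tendsto_zero_ellTwo y
    have hx1 := hx.comp (Filter.tendsto_add_atTop_nat 1)
    have hy1 := hy.comp (Filter.tendsto_add_atTop_nat 1)
    have hz := (hx1.star.mul hy).sub (hx.star.mul hy1)
    simp only [star_zero, mul_zero, sub_zero] at hz
    have hn := (hz.norm).const_mul (|a| + 1)
    rw [norm_zero, mul_zero] at hn
    refine squeeze_zero_norm (fun N => ?_) hn
    rw [norm_mul, Complex.norm_real, Real.norm_eq_abs]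
    exact mul_le_mul_of_nonneg_right (abs_jacobiWeight_le a N) (norm_nonneg _)
  have hd2 := hd'.congr (fun N => hs N)
  exact sub_eq_zero.1 (tendsto_nhds_unique hd2 h0)

/-- The Jacobi operator `J_a`: the bounded operator on `ℓ²(ℕ)` with matrix `jacobiMatrix a`
in the standard basis. Boundedness comes from symmetry (Hellinger–Toeplitz). -/
noncomputable def jacobiOp (a : ℝ) : EllTwo →L[ℂ] EllTwo :=
  ⟨jacobiLin a, (jacobiLin_isSymmetric a).continuous⟩

theorem jacobiOp_apply (a : ℝ) (x : EllTwo) (n : ℕ) : jacobiOp a x n = jacobiFun a x n := rfl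

theorem jacobiOp_isSelfAdjoint (a : ℝ) : IsSelfAdjoint (jacobiOp a) :=
  ContinuousLinearMap.isSelfAdjoint_iff_isSymmetric.2 (jacobiLin_isSymmetric a)

theorem inner_jacobiOp (a : ℝ) (i j : ℕ) :
    inner ℂ (stdVec i) (jacobiOp a (stdVec j)) = (jacobiMatrix a i j : ℂ) := by
  have : inner ℂ (stdVec i) (jacobiOp a (stdVec j)) = jacobiFun a (stdVec j) i := by
    rw [stdVec, lp.inner_single_left, jacobiOp_apply]
    simp
  rw [this]
  rcases i with _ | i
  · simp only [jacobiFun, stdVec, lp.single_apply, jacobiMatrix, Pi.single_apply]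
    by_cases h : j = 1
    · subst h; simp
    · simp [h, Ne.symm h]
  · simp only [jacobiFun, stdVec, lp.single_apply, jacobiMatrix, Pi.single_apply]
    by_cases h : i = j
    · subst h; simp
    · by_cases h' : i + 2 = j
      · subst h'; simp
      · simp [h, h', Ne.symm h']

/-- `ξ` is cyclic for the bounded operator `X`: the closed linear span of `{X ^ n ξ : n ∈ ℕ}` is
the whole space. -/
def IsCyclicVector {H : Type*} [NormedAddCommGroup H] [InnerProductSpace ℂ H]
    (X : H →L[ℂ] H) (ξ : H) : Prop :=
  (Submodule.span ℂ (Set.range fun n : ℕ => (X ^ n) ξ)).topologicalClosure = ⊤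

/-!
The orthogonal complement `V` of the cyclic subspace generated by `ε_n` consists of the sequences
`x` such that every `J_a ^ k x` vanishes at `n`, and is invariant under `J_a`. If `V` were nonzero
it would contain an eigenvector of `J_a` vanishing at `n`, and there is none:

* `V` is finite-dimensional. An `x ∈ V` whose coordinates `0, …, n - 1` vanish is zero, since the
  vanishing of `J_a x` up to index `j ≥ n` gives that of `x` up to index `j + 1`
  (`eq_zero_of_forall_lt_eq_zero`). Hence `V` embeds in `ℂ ^ n` and, if it is nonzero, the
  restriction of `J_a` to it has an eigenvector.
* An eigenvector of `J_a` has no vanishing coordinate. Write the eigenvalue as `r + r⁻¹` with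
  `‖r‖ ≤ 1`. From index `1` on, the eigenvalue equation is the recurrence with characteristic
  roots `r` and `r⁻¹`, and square-summability excludes the component along `r⁻¹`. So the
  eigenvector is geometric with ratio `r` from index `1` on (`eigenvector_apply_succ`), and its
  coordinate at `0` is determined by the one at `1`.
-/

/-! ### Eigenvectors of the Jacobi operator -/

theorem jacobiWeight_ne_zero {a : ℝ} (ha : a ≠ 0) (n : ℕ) : (jacobiWeight a n : ℂ) ≠ 0 := by
  unfold jacobiWeight
  split_ifs <;> simp [ha]

theorem Complex.exists_norm_le_one_sq_add_one (z : ℂ) :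
    ∃ r : ℂ, r ≠ 0 ∧ ‖r‖ ≤ 1 ∧ r ^ 2 + 1 = z * r := by
  obtain ⟨s, hs⟩ := IsAlgClosed.exists_pow_nat_eq (z ^ 2 - 4) (n := 2) (by norm_num)
  -- the two roots of `X ^ 2 - z * X + 1` have product `1`
  have hp : ((z + s) / 2) * ((z - s) / 2) = 1 := by linear_combination -hs / 4
  rcases le_total ‖(z + s) / 2‖ 1 with h | h
  · exact ⟨(z + s) / 2, left_ne_zero_of_mul_eq_one hp, h, by linear_combination hs / 4⟩
  · refine ⟨(z - s) / 2, right_ne_zero_of_mul_eq_one hp, ?_, by linear_combination hs / 4⟩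
    have hn := congrArg norm hp
    rw [norm_mul, norm_one] at hn
    nlinarith [norm_nonneg ((z - s) / 2)]

/-- From index `1` on, an eigenvector of `J_a` for the eigenvalue `r + r⁻¹`, `‖r‖ ≤ 1`, is
geometric with ratio `r`. -/
theorem eigenvector_apply_succ {a : ℝ} {z r : ℂ} {v : EllTwo} (hv : jacobiOp a v = z • v)
    (hr : ‖r‖ ≤ 1) (hz : r ^ 2 + 1 = z * r) (k : ℕ) : v (k + 1) = r ^ k * v 1 := by
  have hrec (k : ℕ) : v (k + 1) + v (k + 3) = z * v (k + 2) := by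
    have h : jacobiFun a v (k + 2) = z * v (k + 2) := by rw [← jacobiOp_apply, hv]; rfl
    simpa [jacobiFun, jacobiWeight] using h
  -- `v (k + 2) - r * v (k + 1)` is the component of `v` along the root `r⁻¹`
  have hstep (k : ℕ) : r ^ k * (v (k + 2) - r * v (k + 1)) = v 2 - r * v 1 := by
    induction k with
    | zero => simp
    | succ k ih =>
      rw [← ih, pow_succ]
      linear_combination r ^ (k + 1) * hrec k - r ^ k * v (k + 2) * hz
  have hlim : Filter.Tendsto (fun k => v (k + 2) - r * v (k + 1)) Filter.atTop (nhds 0) := by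
    have h := tendsto_zero_ellTwo v
    simpa using (h.comp (Filter.tendsto_add_atTop_nat 2)).sub
      ((h.comp (Filter.tendsto_add_atTop_nat 1)).const_mul r)
  have hzero : v 2 - r * v 1 = 0 := by
    refine norm_le_zero_iff.1 (ge_of_tendsto' (tendsto_zero_iff_norm_tendsto_zero.1 hlim) ?_)
    intro k
    rw [← hstep k, norm_mul, norm_pow]
    exact mul_le_of_le_one_left (norm_nonneg _) (pow_le_one₀ (norm_nonneg _) hr)
  have hr0 : r ≠ 0 := by rintro rfl; norm_num at hz
  induction k with
  | zero => simp
  | succ k ih =>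
    have h := hstep k
    rw [hzero] at h
    have h' := (mul_eq_zero.1 h).resolve_left (pow_ne_zero k hr0)
    linear_combination h' + r * ih

theorem eigenvector_apply_ne_zero {a : ℝ} (ha : a ≠ 0) {z : ℂ} {v : EllTwo}
    (hv : jacobiOp a v = z • v) (hv0 : v ≠ 0) (n : ℕ) : v n ≠ 0 := by
  intro hn
  obtain ⟨r, hr0, hr, hz⟩ := Complex.exists_norm_le_one_sq_add_one z
  have hgeom := eigenvector_apply_succ hv hr hz
  have hrow : (a : ℂ) * v 0 + v 2 = z * v 1 := by
    have h : jacobiFun a v 1 = z * v 1 := by rw [← jacobiOp_apply, hv]; rfl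
    simpa [jacobiFun, jacobiWeight] using h
  have h01 : r * (a * v 0) = v 1 := by
    have h2 : v 2 = r * v 1 := by simpa using hgeom 1
    linear_combination r * hrow - r * h2 - v 1 * hz
  have h1 : v 1 = 0 := by
    rcases n with _ | n
    · rw [← h01, hn]; simp
    · rw [hgeom n] at hn
      exact (mul_eq_zero.1 hn).resolve_left (pow_ne_zero n hr0)
  apply hv0
  apply lp.ext
  funext k
  rcases k with _ | k
  · rw [h1] at h01
    simpa [hr0, ha] using h01
  · simp [hgeom k, h1]

/-! ### Invariant subspaces with a vanishing coordinate -/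

theorem eq_zero_of_forall_lt_eq_zero {a : ℝ} (ha : a ≠ 0) {n : ℕ} {V : Submodule ℂ EllTwo}
    (hJ : ∀ x ∈ V, jacobiOp a x ∈ V) (hn : ∀ x ∈ V, x n = 0) {x : EllTwo} (hx : x ∈ V)
    (hlt : ∀ i < n, x i = 0) : x = 0 := by
  have key (m : ℕ) : ∀ x ∈ V, (∀ i < n, x i = 0) → ∀ j ≤ n + m, x j = 0 := by
    induction m with
    | zero =>
      intro x hx hlt j hj
      rcases hj.lt_or_eq with h | rfl
      · exact hlt j h
      · exact hn x hx
    | succ m ih =>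
      intro x hx hlt j hj
      have hprev := ih x hx hlt
      rcases hj.lt_or_eq with h | rfl
      · exact hprev j (by omega)
      have hJx : jacobiFun a x (n + m) = 0 := by
        refine ih (jacobiOp a x) (hJ x hx) (fun i hi => ?_) (n + m) le_rfl
        rw [jacobiOp_apply]
        rcases i with _ | i
        · simp [jacobiFun, hprev 1 (by omega)]
        · simp [jacobiFun, hprev i (by omega), hprev (i + 2) (by omega)]
      rw [← add_assoc]
      rcases hk : n + m with _ | k
      · rw [hk] at hJx
        exact (mul_eq_zero.1 hJx).resolve_left (jacobiWeight_ne_zero ha 0)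
      · rw [hk] at hJx
        simp only [jacobiFun, hprev k (by omega), mul_zero, zero_add] at hJx
        exact (mul_eq_zero.1 hJx).resolve_left (jacobiWeight_ne_zero ha (k + 1))
  apply lp.ext
  funext j
  exact key j x hx hlt j (by omega)

theorem eq_bot_of_forall_apply_eq_zero {a : ℝ} (ha : a ≠ 0) {n : ℕ} {V : Submodule ℂ EllTwo}
    (hJ : ∀ x ∈ V, jacobiOp a x ∈ V) (hn : ∀ x ∈ V, x n = 0) : V = ⊥ := by
  by_contra hV
  let coords : V →ₗ[ℂ] (Fin n → ℂ) :=
    { toFun := fun x i => (x : EllTwo) i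
      map_add' := fun _ _ => rfl
      map_smul' := fun _ _ => rfl }
  have hinj : Function.Injective coords := by
    refine (injective_iff_map_eq_zero coords).2 fun x hx => Subtype.ext ?_
    exact eq_zero_of_forall_lt_eq_zero ha hJ hn x.2 fun i hi => congrFun hx ⟨i, hi⟩
  have : FiniteDimensional ℂ V := FiniteDimensional.of_injective coords hinj
  have : Nontrivial V := Submodule.nontrivial_iff_ne_bot.2 hV
  obtain ⟨z, hz⟩ := Module.End.exists_eigenvalue ((jacobiOp a : EllTwo →ₗ[ℂ] EllTwo).restrict hJ)
  obtain ⟨v, hv⟩ := hz.exists_hasEigenvector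
  have hv' : jacobiOp a (v : EllTwo) = z • (v : EllTwo) := congrArg Subtype.val hv.apply_eq_smul
  exact eigenvector_apply_ne_zero ha hv' (fun h => hv.2 (Subtype.ext h)) n (hn v v.2)

/-! ### The orthogonal complement of the cyclic subspace -/

theorem mem_orthogonal_span_range_pow_iff {a : ℝ} {n : ℕ} {x : EllTwo} :
    x ∈ (Submodule.span ℂ (Set.range fun k : ℕ => (jacobiOp a ^ k) (stdVec n)))ᗮ ↔
      ∀ k : ℕ, (jacobiOp a ^ k) x n = 0 := by
  have hinner (k : ℕ) :
      inner ℂ ((jacobiOp a ^ k) (stdVec n)) x = (jacobiOp a ^ k) x n := by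
    have hsymm := ContinuousLinearMap.isSelfAdjoint_iff_isSymmetric.1
      ((jacobiOp_isSelfAdjoint a).pow k)
    refine (hsymm (stdVec n) x).trans ?_
    rw [stdVec, lp.inner_single_left]
    change inner ℂ (1 : ℂ) ((jacobiOp a ^ k) x n) = _
    rw [RCLike.inner_apply, map_one, mul_one]
  constructor
  · intro hx k
    rw [← hinner]
    exact hx _ (Submodule.subset_span ⟨k, rfl⟩)
  · intro hx
    rw [← Submodule.span_singleton_le_iff_mem, ← Submodule.isOrtho_iff_le, Submodule.isOrtho_comm,
      Submodule.isOrtho_span]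
    rintro _ ⟨k, rfl⟩ _ rfl
    rw [hinner, hx]

theorem mainTheorem2 (a : ℝ) (ha : 0 < a) (n : ℕ) :
    IsCyclicVector (jacobiOp a) (stdVec n) := by
  rw [IsCyclicVector, Submodule.topologicalClosure_eq_top_iff]
  refine eq_bot_of_forall_apply_eq_zero (n := n) ha.ne' (fun x hx => ?_) fun x hx => ?_
  · rw [mem_orthogonal_span_range_pow_iff] at hx ⊢
    intro k
    have h := hx (k + 1)
    rwa [pow_succ] at h
  · exact mem_orthogonal_span_range_pow_iff.1 hx 0
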